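/- Let $M$ be a non-empty smooth ($C^\infty$, Hausdorff, second countable) manifold without boundary of finite dimension $n\ge 1$. Let $T^0M=M$, $T^{r+1}M=T(T^rM)$, let $\pi_r\colon T^{r+1}M\to T^rM$ be the bundle projection, and let $D\phi$ denote the tangent map of $\phi$. For $r\ge 0$ let $T^{r+1}M\setminus 0$ be the open set of those $\xi\in T^{r+1}M$ for which $(D\pi_{T^rM\to M})(\xi)\in TM$ is a non-zero vector, where $\pi_{T^rM\to M}=\pi_0\circ\cdots\circ\pi_{r-1}$. A *semispray* on $T^rM$ is a smooth vector field $S$ on $T^{r+1}M\setminus 0$ with $D\pi_r\circ S=\mathrm{id}$. A *geodesic* of $S$ is a smooth curve $\gamma\colon I\to T^rM$ on an open interval $I\subset\mathbb R$ such that $\gamma'(t)\in T^{r+1}M\setminus 0$ for all $t\in I$ and $\gamma''=S\circ\gamma'$. For $k\ge 2$ let $\kappa_k\colon T^kM\to T^kM$ be the canonical involution of $TT(T^{k-2}M)$, given in induced coordinates by $(x,y,X,Y)\mapsto(x,X,y,Y)$. The iterated complete lifts of a semispray $S$ on $M$ are the semisprays $S^{(r)}$ on $T^rM$ defined by $S^{(0)}=S$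 and $$S^{(r+1)}=D\kappa_{r+2}\circ\kappa_{r+3}\circ DS^{(r)}\circ\kappa_{r+2},\qquad r\ge 0.$$ A *Jacobi field* of $S$ is a geodesic of $S^{(1)}$. Define the canonical projections $p^{(r)}_1,\ldots,p^{(r)}_r\colon T^rM\to TM$, $r\ge 1$, by $p^{(1)}_1=\mathrm{id}_{TM}$ and, for $r\ge 2$, $$p^{(r)}_i=p^{(r-1)}_i\circ\pi_{r-1}\quad(1\le i\le r-1),\qquad p^{(r)}_r=p^{(r-1)}_{r-1}\circ D\pi_{r-2}.$$ Then for every $r\ge 1$ the $r$ maps $p^{(r)}_1,\ldots,p^{(r)}_r$ are smooth and pairwise distinct, and for every semispray $S$ on $M$ and every geodesic $j\colon I\to T^rM$ of $S^{(r)}$, each of the curves $p^{(r)}_1\circ j,\ldots,p^{(r)}_r\circ j\colon I\to TM$ is a geodesic of $S^{(1)}$, that is, a Jacobi field of $S$. -/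

import Mathlib

open scoped Manifold ContDiff

noncomputable section

universe u

/-- A finite-dimensional `C^∞` manifold without boundary, bundled with its model, so that the
tangent bundle construction can be iterated. -/
structure SmoothMfd where
  /-- the model vector space -/
  E : Type
  [normedAddCommGroup : NormedAddCommGroup E]
  [normedSpace : NormedSpace ℝ E]
  [finiteDimensional : FiniteDimensional ℝ E]
  /-- the model space of the charts -/
  H : Type
  [topH : TopologicalSpace H]
  /-- the model with corners -/
  I : ModelWithCorners ℝ E H
  [boundaryless : I.Boundaryless]
  /-- the underlying set of points -/
  carrier : Type u
  [top : TopologicalSpace carrier]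
  [charted : ChartedSpace H carrier]
  [smooth : IsManifold I ∞ carrier]

namespace SmoothMfd

instance : CoeSort SmoothMfd.{u} (Type u) := ⟨SmoothMfd.carrier⟩

attribute [instance] normedAddCommGroup normedSpace finiteDimensional topH boundaryless top
  charted smooth

/-- A smooth manifold modelled on `ℝⁿ`, as a bundled manifold. -/
def of (n : ℕ) (M : Type u) [TopologicalSpace M] [ChartedSpace (EuclideanSpace ℝ (Fin n)) M]
    [IsManifold (𝓡 n) ∞ M] : SmoothMfd.{u} where
  E := EuclideanSpace ℝ (Fin n)
  H := EuclideanSpace ℝ (Fin n)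
  I := 𝓡 n
  carrier := M

/-- The tangent bundle `TN`, with Mathlib's manifold structure. -/
def T (N : SmoothMfd.{u}) : SmoothMfd.{u} where
  E := N.E × N.E
  H := ModelProd N.H N.E
  I := N.I.tangent
  carrier := TangentBundle N.I N

/-- The tangent bundle projection `TN → N`. -/
def proj (N : SmoothMfd.{u}) : N.T → N := fun (ξ : TangentBundle N.I N) => ξ.proj

/-- The tangent map `Df : TN → TP` of a map `f : N → P`. -/
def D {N P : SmoothMfd.{u}} (f : N → P) : N.T → P.T := tangentMap N.I P.I f

/-- The tangent `γ' : ℝ → TN` of a curve `γ`, `γ'(t) = (γ(t), dγ/dt)`. -/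
def velocity {N : SmoothMfd.{u}} (γ : ℝ → N) : ℝ → N.T :=
  fun t => tangentMap 𝓘(ℝ, ℝ) N.I γ ⟨t, (1 : ℝ)⟩

/-- The canonical involution of `TTN`, `(x, y, X, Y) ↦ (x, X, y, Y)` in induced coordinates.
In Mathlib the fibre of `TN` over `x` is the model space `E`, a vector being represented by its
components in the preferred chart of `N` at `x`; the preferred chart of `TN` at `(x, y)` is
the one induced by that same chart, so the fibre of `TTN` over `(x, y)` is `E × E` with
the components `(X, Y)` in the induced coordinates. Points with the same `x` hence use the same
chart, and the formula below is the coordinate formula in it. -/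
def flip (N : SmoothMfd.{u}) : N.T.T → N.T.T :=
  fun (ξ : TangentBundle N.I.tangent (TangentBundle N.I N)) =>
    let x : N := ξ.proj.proj
    let y : N.E := ξ.proj.2
    let w : N.E × N.E := ξ.2
    let η : TangentBundle N.I.tangent (TangentBundle N.I N) := ⟨⟨x, w.1⟩, (y, w.2)⟩
    η

/-- The iterated tangent bundle `T^r M`: `T^0 M = M`, `T^{r+1} M = T(T^r M)`. -/
def iter (M : SmoothMfd.{u}) : ℕ → SmoothMfd.{u}
  | 0 => M
  | r + 1 => (M.iter r).T

/-- The projection `T^r M → M`. -/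
def toBase (M : SmoothMfd.{u}) : (r : ℕ) → M.iter r → M
  | 0 => id
  | r + 1 => M.toBase r ∘ (M.iter r).proj

/-- The slashed tangent bundle `T^{r+1} M ∖ 0`: the `ξ ∈ T^{r+1} M` with
`D(T^r M → M)(ξ) ∈ TM` a non-zero vector (for `r = 0`, this says that `ξ` is non-zero). -/
def slashed (M : SmoothMfd.{u}) (r : ℕ) : Set (M.iter (r + 1)) :=
  {ξ | (D (M.toBase r) ξ : TangentBundle M.I M).2 ≠ 0}

/-- `S` is a semispray on `T^r M`: a smooth vector field on `T^{r+1} M ∖ 0` with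
`D(π_r) ∘ S = id`. The values of `S` outside `T^{r+1} M ∖ 0` are irrelevant. -/
structure IsSemispray (M : SmoothMfd.{u}) (r : ℕ) (S : M.iter (r + 1) → M.iter (r + 2)) :
    Prop where
  contMDiffOn : ContMDiffOn (M.iter (r + 1)).I (M.iter (r + 2)).I ∞ S (M.slashed r)
  proj_eq : ∀ ξ ∈ M.slashed r, (M.iter (r + 1)).proj (S ξ) = ξ
  D_proj_eq : ∀ ξ ∈ M.slashed r, D (M.iter r).proj (S ξ) = ξ

/-- The curve `γ : I → T^r M` is a geodesic of `S`: it is smooth, it is regular (that is,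
`γ'(t) ∈ T^{r+1} M ∖ 0` for `t ∈ I`), and `γ'' = S ∘ γ'` on `I`. It is used for open `I`, where
only the values of `γ` on `I` matter. -/
structure IsGeodesicOn (M : SmoothMfd.{u}) (r : ℕ) (S : M.iter (r + 1) → M.iter (r + 2))
    (I : Set ℝ) (γ : ℝ → M.iter r) : Prop where
  contMDiffOn : ContMDiffOn 𝓘(ℝ, ℝ) (M.iter r).I ∞ γ I
  regular : ∀ t ∈ I, velocity γ t ∈ M.slashed r
  geodesic_eq : ∀ t ∈ I, velocity (velocity γ) t = S (velocity γ t)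

/-- The iterated complete lifts `S^{(r)}` of a semispray `S` on `M`: `S^{(0)} = S` and
`S^{(r+1)} = Dκ_{r+2} ∘ κ_{r+3} ∘ DS^{(r)} ∘ κ_{r+2}`, where `κ_{k+2}` is the canonical
involution of `T^{k+2} M = TT(T^k M)`. -/
def completeLift (M : SmoothMfd.{u}) (S : M.iter 1 → M.iter 2) :
    (r : ℕ) → M.iter (r + 1) → M.iter (r + 2)
  | 0 => S
  | r + 1 =>
    let κ₂ : M.iter (r + 2) → M.iter (r + 2) := (M.iter r).flip
    let κ₃ : M.iter (r + 3) → M.iter (r + 3) := (M.iter (r + 1)).flip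
    let DS : M.iter (r + 2) → M.iter (r + 3) := D (M.completeLift S r)
    let Dκ₂ : M.iter (r + 3) → M.iter (r + 3) := D κ₂
    Dκ₂ ∘ κ₃ ∘ DS ∘ κ₂

/-- The canonical projections `p^{(r)}_1, …, p^{(r)}_r : T^r M → TM` (indexed from `0`):
`p^{(1)}_1 = id`, and for `r ≥ 2`, `p^{(r)}_i = p^{(r-1)}_i ∘ π_{r-1}` for `i < r` and
`p^{(r)}_r = p^{(r-1)}_{r-1} ∘ Dπ_{r-2}`. -/
def canonicalProj (M : SmoothMfd.{u}) : (r : ℕ) → Fin r → M.iter r → M.iter 1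
  | 0 => fun i => i.elim0
  | 1 => fun _ => id
  | r + 2 => Fin.lastCases (motive := fun _ => M.iter (r + 2) → M.iter 1)
      (M.canonicalProj (r + 1) (Fin.last r) ∘ D (M.iter r).proj)
      (fun i => M.canonicalProj (r + 1) i ∘ (M.iter (r + 1)).proj)

end SmoothMfd

end

/-! Let `f` be a smooth map over `M` between iterated tangent bundles with `DDf ∘ S = S' ∘ Df` on
the slashed bundle. It carries geodesics of `S` to geodesics of `S'`, since `(f ∘ γ)'' = DDf(γ'') =
DDf(S(γ')) = S'((f ∘ γ)')` (`IsGeodesicOn.comp`). Canonical projections are composites of maps `π`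
and `Dπ`, so it suffices that these relate consecutive complete lifts. For `π`, the identities `Dπ ∘
κ = π` and `π ∘ κ = Dπ` cancel the involutions in the lift (`D_D_proj_lift`). For `Dπ`, naturality
`DDf ∘ κ = κ ∘ DDf` shows that relatedness through `f` passes to the lifts through `Df`
(`D_D_D_lift`). The analytic input is that `κ` is smooth and natural; in charts both reduce to
symmetry of second derivatives. Distinctness: the last projection separates two points of a fibre of
`π`, on which all the others are constant. -/

noncomputable section

namespace IteratedTangent

open Bundle Set Filter Topology

/-! ### Second tangent maps in vector spaces. -/

section Linear

variable {E E' : Type*} [NormedAddCommGroup E] [NormedSpace ℝ E]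
  [NormedAddCommGroup E'] [NormedSpace ℝ E']

/-- The tangent map of a map between vector spaces, in the trivializations of the tangent
bundles by translations. -/
def vecTangentMap (F : E → E') (p : E × E) : E' × E' := (F p.1, fderiv ℝ F p.1 p.2)

theorem hasFDerivAt_vecTangentMap {F : E → E'} {u : E} (hF : ContDiffAt ℝ 2 F u) (v : E) :
    HasFDerivAt (vecTangentMap F)
      (((fderiv ℝ F u).comp (ContinuousLinearMap.fst ℝ E E)).prod
        ((fderiv ℝ F u).comp (ContinuousLinearMap.snd ℝ E E) +
          ((fderiv ℝ (fderiv ℝ F) u).comp (ContinuousLinearMap.fst ℝ E E)).flip v)) (u, v) := by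
  have h1 : HasFDerivAt F (fderiv ℝ F u) u :=
    (hF.differentiableAt (by norm_num)).hasFDerivAt
  have h2 : HasFDerivAt (fderiv ℝ F) (fderiv ℝ (fderiv ℝ F) u) u :=
    ((hF.fderiv_right (m := 1) (by norm_num)).differentiableAt (by norm_num)).hasFDerivAt
  have hfst : HasFDerivAt (Prod.fst : E × E → E) (ContinuousLinearMap.fst ℝ E E) (u, v) :=
    hasFDerivAt_fst
  have hsnd : HasFDerivAt (Prod.snd : E × E → E) (ContinuousLinearMap.snd ℝ E E) (u, v) :=
    hasFDerivAt_snd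
  exact (HasFDerivAt.comp (u, v) (f := Prod.fst) h1 hfst).prodMk
    ((HasFDerivAt.comp (u, v) (f := Prod.fst) h2 hfst).clm_apply hsnd)

/-- Exchanging `v` and `X` affects the second-order term only through the order of its arguments;
this is the source of every property of the involution. -/
theorem fderiv_vecTangentMap {F : E → E'} {u : E} (hF : ContDiffAt ℝ 2 F u) (v X Y : E) :
    fderiv ℝ (vecTangentMap F) (u, v) (X, Y) =
      (fderiv ℝ F u X, fderiv ℝ F u Y + fderiv ℝ (fderiv ℝ F) u X v) := by
  rw [(hasFDerivAt_vecTangentMap hF v).fderiv]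
  rfl

theorem fderiv_fderiv_comm {F : E → E'} {u : E} (hF : ContDiffAt ℝ 2 F u) (v w : E) :
    fderiv ℝ (fderiv ℝ F) u v w = fderiv ℝ (fderiv ℝ F) u w v :=
  hF.isSymmSndFDerivAt (by simp) v w

end Linear

/-! ### Tangent maps in induced charts; naturality of the involution. -/

section Manifold

variable {E : Type*} [NormedAddCommGroup E] [NormedSpace ℝ E] {H : Type*} [TopologicalSpace H]
  {I : ModelWithCorners ℝ E H} {M : Type*} [TopologicalSpace M] [ChartedSpace H M]
  [IsManifold I ∞ M]
  {E' : Type*} [NormedAddCommGroup E'] [NormedSpace ℝ E'] {H' : Type*} [TopologicalSpace H']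
  {I' : ModelWithCorners ℝ E' H'} {M' : Type*} [TopologicalSpace M'] [ChartedSpace H' M']
  [IsManifold I' ∞ M']

theorem extChartAt_tangent_self (x : M) (y : E) :
    extChartAt I.tangent (⟨x, y⟩ : TangentBundle I M) ⟨x, y⟩ = (extChartAt I x x, y) :=
  Prod.ext rfl (tangentCoordChange_self (mem_extChartAt_source _))

theorem extChartAt_tangent_source (p : TangentBundle I M) :
    (extChartAt I.tangent p).source =
      (TotalSpace.proj : TangentBundle I M → M) ⁻¹' (extChartAt I p.proj).source := by
  ext q
  simp only [extChartAt_source, mem_preimage, TangentBundle.mem_chart_source_iff]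

variable [I.Boundaryless]

omit [I.Boundaryless] in
theorem hasMFDerivAt_extChartAt_tangentCoordChange {x z : M}
    (hz : z ∈ (extChartAt I x).source) :
    HasMFDerivAt I 𝓘(ℝ, E) (extChartAt I x) z (tangentCoordChange I z x z : E →L[ℝ] E) := by
  rw [extChartAt_source] at hz
  have := hasMFDerivAt_extChartAt (I := I) hz
  rwa [mfderiv_chartAt_eq_tangentCoordChange hz] at this

theorem hasMFDerivAt_extChartAt_symm_tangentCoordChange {x : M} {u : E}
    (hu : u ∈ (extChartAt I x).target) :
    HasMFDerivAt 𝓘(ℝ, E) I (extChartAt I x).symm u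
      (tangentCoordChange I x ((extChartAt I x).symm u) ((extChartAt I x).symm u) : E →L[ℝ] E) := by
  refine ⟨continuousAt_extChartAt_symm'' hu, ?_⟩
  have h := hasFDerivWithinAt_tangentCoordChange (I := I)
    (x := x) (y := (extChartAt I x).symm u) (z := (extChartAt I x).symm u)
    ⟨(extChartAt I x).map_target hu, mem_extChartAt_source _⟩
  rw [(extChartAt I x).right_inv hu, I.range_eq_univ] at h
  exact h.mono (subset_univ _)

theorem hasFDerivAt_writtenInExtChartAt {f : M → M'} {x : M} {u : E}
    (hu : u ∈ (extChartAt I x).target)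
    (hf : MDifferentiableAt I I' f ((extChartAt I x).symm u))
    (hfu : f ((extChartAt I x).symm u) ∈ (extChartAt I' (f x)).source) :
    HasFDerivAt (writtenInExtChartAt I I' x f)
      ((tangentCoordChange I' (f ((extChartAt I x).symm u)) (f x)
          (f ((extChartAt I x).symm u))).comp
        ((mfderiv I I' f ((extChartAt I x).symm u) : E →L[ℝ] E').comp
        (tangentCoordChange I x ((extChartAt I x).symm u) ((extChartAt I x).symm u)))) u := by
  have h1 := hasMFDerivAt_extChartAt_symm_tangentCoordChange hu
  have h2 := HasMFDerivAt.comp u hf.hasMFDerivAt h1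
  have h3 := HasMFDerivAt.comp u (hasMFDerivAt_extChartAt_tangentCoordChange hfu) h2
  exact hasMFDerivAt_iff_hasFDerivAt.1 h3

theorem writtenInExtChartAt_tangentMap {f : M → M'} (p : TangentBundle I M) {u v : E}
    (hu : u ∈ (extChartAt I p.proj).target)
    (hf : MDifferentiableAt I I' f ((extChartAt I p.proj).symm u))
    (hfu : f ((extChartAt I p.proj).symm u) ∈ (extChartAt I' (f p.proj)).source) :
    writtenInExtChartAt I.tangent I'.tangent p (tangentMap I I' f) (u, v) =
      vecTangentMap (writtenInExtChartAt I I' p.proj f) (u, v) := by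
  rw [vecTangentMap, (hasFDerivAt_writtenInExtChartAt hu hf hfu).fderiv]
  rfl

omit [IsManifold I ∞ M] [IsManifold I' ∞ M'] in
theorem mfderiv_apply_eq_fderiv {f : M → M'} {x : M} (hf : MDifferentiableAt I I' f x) (v : E) :
    mfderiv I I' f x v =
      fderiv ℝ (writtenInExtChartAt I I' x f) (extChartAt I x x) v := by
  obtain ⟨L, hL⟩ : ∃ L : E →L[ℝ] E', L = mfderiv I I' f x := ⟨_, rfl⟩
  have h : HasFDerivWithinAt (writtenInExtChartAt I I' x f) L (range I) (extChartAt I x x) :=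
    hL ▸ hf.hasMFDerivAt.2
  rw [I.range_eq_univ, hasFDerivWithinAt_univ] at h
  rw [h.fderiv, hL]
  rfl

/-- Equality near the point, not just at it, allows a further differentiation. -/
theorem eventually_writtenInExtChartAt_tangentMap {f : M → M'} (hf : ContMDiff I I' ∞ f)
    (x : M) (y : E) :
    writtenInExtChartAt I.tangent I'.tangent (⟨x, y⟩ : TangentBundle I M) (tangentMap I I' f)
      =ᶠ[𝓝 (extChartAt I x x, y)] vecTangentMap (writtenInExtChartAt I I' x f) := by
  have h1 : ∀ᶠ u in 𝓝 (extChartAt I x x), u ∈ (extChartAt I x).target :=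
    extChartAt_target_mem_nhds x
  have h2 : ∀ᶠ u in 𝓝 (extChartAt I x x),
      f ((extChartAt I x).symm u) ∈ (extChartAt I' (f x)).source := by
    apply ContinuousAt.eventually_mem (f := f ∘ (extChartAt I x).symm)
      (hf.continuous.continuousAt.comp (continuousAt_extChartAt_symm x))
    rw [Function.comp_apply, extChartAt_to_inv]
    exact extChartAt_source_mem_nhds _
  rw [nhds_prod_eq]
  filter_upwards [(h1.and h2).prod_inl _] with q hq
  exact writtenInExtChartAt_tangentMap (⟨x, y⟩ : TangentBundle I M) hq.1
    (hf.mdifferentiable (by simp) _) hq.2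

omit [IsManifold I ∞ M] [IsManifold I' ∞ M'] in
theorem contDiffAt_writtenInExtChartAt {f : M → M'} (hf : ContMDiff I I' ∞ f) (x : M) :
    ContDiffAt ℝ ∞ (writtenInExtChartAt I I' x f) (extChartAt I x x) := by
  have := (contMDiffAt_iff.1 (hf x)).2
  rwa [I.range_eq_univ, contDiffWithinAt_univ] at this

theorem mfderiv_tangentMap {f : M → M'} (hf : ContMDiff I I' ∞ f) (x : M) (y X Y : E) :
    mfderiv I.tangent I'.tangent (tangentMap I I' f) ⟨x, y⟩ (by exact (X, Y)) =
      (by exact (fderiv ℝ (writtenInExtChartAt I I' x f) (extChartAt I x x) X,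
        fderiv ℝ (writtenInExtChartAt I I' x f) (extChartAt I x x) Y +
        fderiv ℝ (fderiv ℝ (writtenInExtChartAt I I' x f)) (extChartAt I x x) X y)) := by
  have hTf : ContMDiff I.tangent I'.tangent ∞ (tangentMap I I' f) :=
    hf.contMDiff_tangentMap (by simp)
  refine (mfderiv_apply_eq_fderiv (hTf.mdifferentiable (by simp) _) (X, Y)).trans ?_
  rw [extChartAt_tangent_self, (eventually_writtenInExtChartAt_tangentMap hf x y).fderiv_eq]
  exact fderiv_vecTangentMap ((contDiffAt_writtenInExtChartAt hf _).of_le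
    (WithTop.coe_le_coe.2 le_top)) y X Y

/-- The canonical involution of the double tangent bundle. -/
def canonicalFlip (ξ : TangentBundle I.tangent (TangentBundle I M)) :
    TangentBundle I.tangent (TangentBundle I M) :=
  ⟨⟨ξ.proj.proj, (show E × E from ξ.2).1⟩, (ξ.proj.2, (show E × E from ξ.2).2)⟩

theorem tangentMap_tangentMap_canonicalFlip {f : M → M'} (hf : ContMDiff I I' ∞ f)
    (ξ : TangentBundle I.tangent (TangentBundle I M)) :
    tangentMap I.tangent I'.tangent (tangentMap I I' f) (canonicalFlip ξ) =
      canonicalFlip (tangentMap I.tangent I'.tangent (tangentMap I I' f) ξ) := by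
  obtain ⟨⟨x, y⟩, w⟩ := ξ
  obtain ⟨X, Y⟩ : E × E := w
  have hfx : MDifferentiableAt I I' f x := hf.mdifferentiable (by simp) x
  have h1 := mfderiv_tangentMap hf x y X Y
  have h2 := mfderiv_tangentMap hf x X y Y
  have hs := fderiv_fderiv_comm ((contDiffAt_writtenInExtChartAt hf x).of_le
    (WithTop.coe_le_coe.2 le_top)) X y
  have e1 : tangentMap I.tangent I'.tangent (tangentMap I I' f) ⟨⟨x, y⟩, (X, Y)⟩ =
      ⟨⟨f x, mfderiv I I' f x y⟩, _⟩ := congrArg _ h1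
  have e2 : tangentMap I.tangent I'.tangent (tangentMap I I' f) ⟨⟨x, X⟩, (y, Y)⟩ =
      ⟨⟨f x, mfderiv I I' f x X⟩, _⟩ := congrArg _ h2
  refine e2.trans (Eq.trans ?_ (congrArg canonicalFlip e1).symm)
  rw [← hs]
  -- The flip exchanges an entry expressed by `mfderiv` with one expressed by a chart derivative, so
  -- the two forms must be identified.
  have e3 := mfderiv_apply_eq_fderiv hfx X
  have e4 := mfderiv_apply_eq_fderiv hfx y
  change (⟨⟨_, _⟩, _⟩ : TangentBundle I'.tangent (TangentBundle I' M')) = ⟨⟨_, _⟩, (_, _)⟩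
  rw [e3, e4]

end Manifold

/-! ### Transition maps of `TTM`; smoothness of the involution. -/

section Flip

variable {E : Type*} [NormedAddCommGroup E] [NormedSpace ℝ E] {H : Type*} [TopologicalSpace H]
  {I : ModelWithCorners ℝ E H} {M : Type*} [TopologicalSpace M] [ChartedSpace H M]
  [IsManifold I ∞ M] [I.Boundaryless]

theorem eventually_extChartAt_tangent_coordChange {x z : M} (y w : E)
    (hz : z ∈ (extChartAt I x).source) :
    extChartAt I.tangent (⟨x, y⟩ : TangentBundle I M) ∘
        (extChartAt I.tangent (⟨z, w⟩ : TangentBundle I M)).symm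
      =ᶠ[𝓝 (extChartAt I z z, w)] vecTangentMap (extChartAt I x ∘ (extChartAt I z).symm) := by
  have h1 : ∀ᶠ u in 𝓝 (extChartAt I z z), u ∈ (extChartAt I z).target :=
    extChartAt_target_mem_nhds z
  have h2 : ∀ᶠ u in 𝓝 (extChartAt I z z), (extChartAt I z).symm u ∈ (extChartAt I x).source := by
    apply (continuousAt_extChartAt_symm z).eventually_mem
    rw [extChartAt_to_inv]
    exact extChartAt_source_mem_nhds' hz
  rw [nhds_prod_eq]
  filter_upwards [(h1.and h2).prod_inl _] with q ⟨hq1, hq2⟩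
  obtain ⟨u, v⟩ := q
  dsimp only at hq1 hq2
  refine Prod.ext rfl ?_
  refine (tangentCoordChange_comp (I := I) (w := z) (x := (extChartAt I z).symm u) (y := x)
    (z := (extChartAt I z).symm u) (v := v)
    ⟨⟨(extChartAt I z).map_target hq1, mem_extChartAt_source _⟩, hq2⟩).trans ?_
  rw [tangentCoordChange_def, I.range_eq_univ, fderivWithin_univ, (extChartAt I z).right_inv hq1]
  rfl

theorem contDiffAt_extChartAt_coordChange {x z : M} (hz : z ∈ (extChartAt I x).source) :
    ContDiffAt ℝ ∞ (extChartAt I x ∘ (extChartAt I z).symm) (extChartAt I z z) := by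
  have := contDiffWithinAt_ext_coord_change (I := I) (n := ∞) x z (y := extChartAt I z z) (by
    rw [PartialEquiv.trans_source'', PartialEquiv.symm_symm, PartialEquiv.symm_target]
    exact mem_image_of_mem _ ⟨mem_extChartAt_source _, hz⟩)
  rwa [I.range_eq_univ, contDiffWithinAt_univ] at this

theorem extChartAt_tangent_tangent_apply {x z : M} (y : E) (Z : E × E) (w X Y : E)
    (hz : z ∈ (extChartAt I x).source) :
    extChartAt I.tangent.tangent
        (⟨⟨x, y⟩, Z⟩ : TangentBundle I.tangent (TangentBundle I M)) ⟨⟨z, w⟩, (X, Y)⟩ =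
      ((extChartAt I x z, fderiv ℝ (extChartAt I x ∘ (extChartAt I z).symm) (extChartAt I z z) w),
       (fderiv ℝ (extChartAt I x ∘ (extChartAt I z).symm) (extChartAt I z z) X,
        fderiv ℝ (extChartAt I x ∘ (extChartAt I z).symm) (extChartAt I z z) Y +
        fderiv ℝ (fderiv ℝ (extChartAt I x ∘ (extChartAt I z).symm)) (extChartAt I z z) X w)) := by
  have hc := (contDiffAt_extChartAt_coordChange (I := I) hz).of_le
    (m := 2) (WithTop.coe_le_coe.2 le_top)
  refine Prod.ext ?_ ?_
  · refine Prod.ext rfl ?_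
    change tangentCoordChange I z x z w = _
    rw [tangentCoordChange_def, I.range_eq_univ, fderivWithin_univ]
  · change tangentCoordChange I.tangent (⟨z, w⟩ : TangentBundle I M) ⟨x, y⟩ ⟨z, w⟩ (X, Y) = _
    rw [tangentCoordChange_def, ModelWithCorners.range_eq_univ, fderivWithin_univ,
      extChartAt_tangent_self, (eventually_extChartAt_tangent_coordChange y w hz).fderiv_eq]
    exact fderiv_vecTangentMap hc w X Y

/-- The canonical involution in coordinates. -/
def coordFlip (E : Type*) : (E × E) × (E × E) → (E × E) × (E × E) :=
  fun q => ((q.1.1, q.2.1), (q.1.2, q.2.2))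

/-- The involution is defined through a chart that varies with the point. Symmetry of the second
derivative of the transition map gives it the same formula in every induced chart. -/
theorem extChartAt_tangent_tangent_canonicalFlip
    (ξ₀ ξ : TangentBundle I.tangent (TangentBundle I M))
    (h : ξ.proj.proj ∈ (extChartAt I ξ₀.proj.proj).source) :
    extChartAt I.tangent.tangent ξ₀ (canonicalFlip ξ) =
      coordFlip E (extChartAt I.tangent.tangent ξ₀ ξ) := by
  obtain ⟨⟨x, y⟩, Z⟩ := ξ₀
  obtain ⟨⟨z, w⟩, V⟩ := ξ
  obtain ⟨X, Y⟩ : E × E := V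
  change E at w
  change E at y
  refine (extChartAt_tangent_tangent_apply y Z X w Y h).trans ?_
  refine Eq.trans ?_ (congrArg (coordFlip E) (extChartAt_tangent_tangent_apply y Z w X Y h)).symm
  rw [fderiv_fderiv_comm ((contDiffAt_extChartAt_coordChange (I := I) h).of_le
    (WithTop.coe_le_coe.2 le_top)) w X]
  rfl

omit [I.Boundaryless] in
theorem mem_extChartAt_tangent_tangent_source
    (ξ₀ ξ : TangentBundle I.tangent (TangentBundle I M)) :
    ξ ∈ (extChartAt I.tangent.tangent ξ₀).source ↔
      ξ.proj.proj ∈ (extChartAt I ξ₀.proj.proj).source := by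
  rw [extChartAt_tangent_source, mem_preimage, extChartAt_tangent_source, mem_preimage]

/-- An induced chart domain depends only on base points in `M`, so one chart contains both `ξ` and
its flip, and there the map is a linear permutation of coordinates. -/
theorem contMDiff_canonicalFlip :
    ContMDiff I.tangent.tangent I.tangent.tangent ∞
      (canonicalFlip : TangentBundle I.tangent (TangentBundle I M) → _) := by
  intro ξ₀
  have hflip : ContDiff ℝ ∞ (coordFlip E) := by
    unfold coordFlip; fun_prop
  set e := extChartAt I.tangent.tangent ξ₀ with he
  have hmem : e (canonicalFlip ξ₀) ∈ e.target :=
    e.map_source ((mem_extChartAt_tangent_tangent_source _ _).2 (mem_extChartAt_source _))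
  have h0 : e (canonicalFlip ξ₀) = coordFlip E (e ξ₀) :=
    extChartAt_tangent_tangent_canonicalFlip ξ₀ ξ₀ (mem_extChartAt_source _)
  have h1 : ContMDiffAt I.tangent.tangent 𝓘(ℝ, (E × E) × (E × E)) ∞ e ξ₀ := contMDiffAt_extChartAt
  have h2 : ContMDiffAt 𝓘(ℝ, (E × E) × (E × E)) 𝓘(ℝ, (E × E) × (E × E)) ∞ (coordFlip E) (e ξ₀) :=
    hflip.contMDiff.contMDiffAt
  have h3 : ContMDiffAt 𝓘(ℝ, (E × E) × (E × E)) I.tangent.tangent ∞ e.symm (coordFlip E (e ξ₀)) :=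
    (contMDiffOn_extChartAt_symm ξ₀).contMDiffAt
      ((isOpen_extChartAt_target ξ₀).mem_nhds (h0 ▸ hmem))
  refine ((h3.comp _ h2).comp ξ₀ h1).congr_of_eventuallyEq ?_
  filter_upwards [extChartAt_source_mem_nhds (I := I.tangent.tangent) ξ₀] with ξ hξ
  have hb := (mem_extChartAt_tangent_tangent_source _ _).1 hξ
  change _ = e.symm (coordFlip E (e ξ))
  rw [← extChartAt_tangent_tangent_canonicalFlip ξ₀ ξ hb]
  exact (e.left_inv ((mem_extChartAt_tangent_tangent_source ξ₀ (canonicalFlip ξ)).2 hb)).symm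

/-- The tangent map of the tangent bundle projection, in coordinates. -/
theorem tangentMap_proj (ξ : TangentBundle I.tangent (TangentBundle I M)) :
    tangentMap I.tangent I (TotalSpace.proj : TangentBundle I M → M) ξ =
      ⟨ξ.proj.proj, (show E × E from ξ.2).1⟩ := by
  obtain ⟨⟨x, y⟩, V⟩ := ξ
  obtain ⟨X, Y⟩ : E × E := V
  change E at y
  have hd : MDifferentiableAt I.tangent I (TotalSpace.proj : TangentBundle I M → M) ⟨x, y⟩ :=
    (contMDiff_proj (TangentSpace I) (n := ∞)).mdifferentiable (by simp) _
  have h := mfderiv_apply_eq_fderiv hd (X, Y)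
  have he : writtenInExtChartAt I.tangent I (⟨x, y⟩ : TangentBundle I M) TotalSpace.proj
      =ᶠ[𝓝 (extChartAt I x x, y)] Prod.fst := by
    rw [nhds_prod_eq]
    filter_upwards [Eventually.prod_inl (extChartAt_target_mem_nhds (I := I) x) _] with q hq
    exact (extChartAt I x).right_inv hq
  rw [extChartAt_tangent_self, he.fderiv_eq, fderiv_fst] at h
  exact congrArg _ h

end Flip

end IteratedTangent

/-! ### Tangent calculus for bundled manifolds. -/

namespace SmoothMfd

open Bundle Set Filter Topology

variable {N P Q : SmoothMfd.{u}}

/-- Smoothness of maps between bundled manifolds. -/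
def Smooth (f : N → P) : Prop := ContMDiff N.I P.I ∞ f

/-- Differentiability at a point of maps between bundled manifolds. -/
def DiffAt (f : N → P) (x : N) : Prop := MDifferentiableAt N.I P.I f x

theorem Smooth.diffAt {f : N → P} (hf : Smooth f) (x : N) : DiffAt f x :=
  ContMDiff.mdifferentiable hf (by simp) x

theorem Smooth.comp {g : P → Q} {f : N → P} (hg : Smooth g) (hf : Smooth f) : Smooth (g ∘ f) :=
  ContMDiff.comp hg hf

theorem smooth_id : Smooth (id : N → N) := contMDiff_id

theorem Smooth.D {f : N → P} (hf : Smooth f) : Smooth (D f) :=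
  ContMDiff.contMDiff_tangentMap hf (by simp)

theorem smooth_proj (N : SmoothMfd.{u}) : Smooth N.proj :=
  contMDiff_proj (IB := N.I) (F := N.E) (TangentSpace N.I : N → Type)

theorem smooth_flip (N : SmoothMfd.{u}) : Smooth N.flip :=
  IteratedTangent.contMDiff_canonicalFlip (I := N.I) (M := N)

theorem proj_D (f : N → P) (ξ : N.T) : P.proj (D f ξ) = f (N.proj ξ) := rfl

theorem D_comp_apply {g : P → Q} {f : N → P} {ξ : N.T} (hg : DiffAt g (f (N.proj ξ)))
    (hf : DiffAt f (N.proj ξ)) : D (g ∘ f) ξ = D g (D f ξ) :=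
  tangentMap_comp_at ξ hg hf

theorem D_congr {f g : N → P} {ξ : N.T} (h : f =ᶠ[𝓝 (N.proj ξ)] g) : D f ξ = D g ξ := by
  have h1 : mfderiv N.I P.I f (N.proj ξ) = mfderiv N.I P.I g (N.proj ξ) := h.mfderiv_eq
  change (⟨f (N.proj ξ), mfderiv N.I P.I f (N.proj ξ) _⟩ : TangentBundle P.I P) =
    ⟨g (N.proj ξ), mfderiv N.I P.I g (N.proj ξ) _⟩
  congr 1
  · exact h.self_of_nhds
  · rw [h1]
    rfl

theorem D_proj_flip (ξ : N.T.T) : D N.proj (N.flip ξ) = N.T.proj ξ :=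
  IteratedTangent.tangentMap_proj (I := N.I) (M := N) (N.flip ξ)

theorem proj_flip (ξ : N.T.T) : N.T.proj (N.flip ξ) = D N.proj ξ :=
  (IteratedTangent.tangentMap_proj (I := N.I) (M := N) ξ).symm

theorem D_D_flip {f : N → P} (hf : Smooth f) (ξ : N.T.T) :
    D (D f) (N.flip ξ) = P.flip (D (D f) ξ) :=
  IteratedTangent.tangentMap_tangentMap_canonicalFlip hf ξ

section Curve

variable {I : Set ℝ} {γ : ℝ → N}

theorem velocity_comp {f : N → P} {t : ℝ} (hf : DiffAt f (γ t))
    (hγ : MDifferentiableAt 𝓘(ℝ, ℝ) N.I γ t) : velocity (f ∘ γ) t = D f (velocity γ t) :=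
  tangentMap_comp_at (I := 𝓘(ℝ, ℝ)) (⟨t, (1 : ℝ)⟩ : TangentBundle 𝓘(ℝ, ℝ) ℝ) hf hγ

theorem velocity_congr {γ₁ γ₂ : ℝ → N} {t : ℝ} (h : γ₁ =ᶠ[𝓝 t] γ₂) :
    velocity γ₁ t = velocity γ₂ t := by
  have h1 : mfderiv 𝓘(ℝ, ℝ) N.I γ₁ t = mfderiv 𝓘(ℝ, ℝ) N.I γ₂ t := h.mfderiv_eq
  change (⟨γ₁ t, mfderiv 𝓘(ℝ, ℝ) N.I γ₁ t _⟩ : TangentBundle N.I N) =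
    ⟨γ₂ t, mfderiv 𝓘(ℝ, ℝ) N.I γ₂ t _⟩
  congr 1
  · exact h.self_of_nhds
  · rw [h1]
    rfl

theorem contMDiffOn_D {f : N → P} {U : Set N} (hU : IsOpen U)
    (hf : ContMDiffOn N.I P.I ∞ f U) : ContMDiffOn N.T.I P.T.I ∞ (D f) (N.proj ⁻¹' U) := by
  refine (hf.contMDiffOn_tangentMapWithin (m := ∞) (by simp) hU.uniqueMDiffOn).congr ?_
  intro ξ hξ
  exact (tangentMapWithin_eq_tangentMap (hU.uniqueMDiffOn _ hξ)
    ((hf.contMDiffAt (hU.mem_nhds hξ)).mdifferentiableAt (by simp))).symm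

theorem contMDiffOn_velocity (hI : IsOpen I) (hγ : ContMDiffOn 𝓘(ℝ, ℝ) N.I ∞ γ I) :
    ContMDiffOn 𝓘(ℝ, ℝ) N.T.I ∞ (velocity γ) I := by
  have h1 : ContMDiff 𝓘(ℝ, ℝ) 𝓘(ℝ, ℝ).tangent ∞
      (fun t : ℝ => (⟨t, (1 : ℝ)⟩ : TangentBundle 𝓘(ℝ, ℝ) ℝ)) :=
    contMDiff_vectorSpace_iff_contDiff.2 contDiff_const
  refine ((hγ.contMDiffOn_tangentMapWithin (m := ∞) (by simp) hI.uniqueMDiffOn).comp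
    h1.contMDiffOn (fun t ht => ht)).congr ?_
  intro t ht
  exact (tangentMapWithin_eq_tangentMap (hI.uniqueMDiffOn _ ht)
    ((hγ.contMDiffAt (hI.mem_nhds ht)).mdifferentiableAt (by simp))).symm

end Curve

/-! ### Complete lifts and related maps. -/

section Lift

variable {N P : SmoothMfd.{u}}

/-- The complete lift of a (not necessarily everywhere smooth) map `TN → TTN`. -/
def lift (S : N.T → N.T.T) : N.T.T → N.T.T.T :=
  D N.flip ∘ N.T.flip ∘ D S ∘ N.flip

theorem contMDiffOn_lift {S : N.T → N.T.T} {U : Set N.T} (hU : IsOpen U)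
    (hS : ContMDiffOn N.T.I N.T.T.I ∞ S U) :
    ContMDiffOn N.T.T.I N.T.T.T.I ∞ (lift S) (D N.proj ⁻¹' U) := by
  have h1 : ContMDiffOn N.T.T.I N.T.T.T.I ∞ (D S ∘ N.flip) (D N.proj ⁻¹' U) :=
    (contMDiffOn_D hU hS).comp (ContMDiff.contMDiffOn (smooth_flip N)) fun ξ hξ => by
      change N.T.proj (N.flip ξ) ∈ U
      rw [proj_flip]
      exact hξ
  have h2 : Smooth (D N.flip ∘ N.T.flip) := (smooth_flip N).D.comp (smooth_flip N.T)
  exact ContMDiff.comp_contMDiffOn (g := D N.flip ∘ N.T.flip) h2 h1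

/-- No regularity of `S` is needed: the chain rule is applied only to `Dπ ∘ κ`, and `DS` enters only
through its base point. -/
theorem D_D_proj_lift (S : N.T → N.T.T) (ξ : N.T.T) :
    D (D N.proj) (lift S ξ) = S (D N.proj ξ) := by
  have h : D N.proj ∘ N.flip = N.T.proj := funext D_proj_flip
  change D (D N.proj) (D N.flip (N.T.flip (D S (N.flip ξ)))) = _
  rw [← D_comp_apply ((smooth_proj N).D.diffAt _) ((smooth_flip N).diffAt _), h, D_proj_flip,
    proj_D, proj_flip]

/-- Differentiate the relation `DDf ∘ S = S' ∘ Df` and move the iterated tangent maps of `f` past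
each flip by naturality. -/
theorem D_D_D_lift {f : N → P} (hf : Smooth f) {S : N.T → N.T.T} {S' : P.T → P.T.T} {ξ : N.T.T}
    (hS : DiffAt S (D N.proj ξ)) (hS' : DiffAt S' (D f (D N.proj ξ)))
    (h : ∀ᶠ η in 𝓝 (D N.proj ξ), D (D f) (S η) = S' (D f η)) :
    D (D (D f)) (lift S ξ) = lift S' (D (D f) ξ) := by
  have hflip : D (D f) ∘ N.flip = P.flip ∘ D (D f) := funext (D_D_flip hf)
  have h1 : D (D (D f)) (D S (N.flip ξ)) = D S' (D (D f) (N.flip ξ)) := by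
    rw [← D_comp_apply (hf.D.D.diffAt _) (by rwa [proj_flip]),
      ← D_comp_apply (by rwa [proj_flip]) (hf.D.diffAt _)]
    exact D_congr (by rw [proj_flip]; exact h)
  change D (D (D f)) (D N.flip (N.T.flip (D S (N.flip ξ)))) =
    D P.flip (P.T.flip (D S' (P.flip (D (D f) ξ))))
  rw [← D_comp_apply (hf.D.D.diffAt _) ((smooth_flip N).diffAt _), hflip,
    D_comp_apply ((smooth_flip P).diffAt _) (hf.D.D.diffAt _), D_D_flip hf.D, h1, D_D_flip hf]

end Lift

/-! ### Slashed bundles and the iterated lifts. -/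

variable (M : SmoothMfd.{u})

theorem smooth_toBase : ∀ r, Smooth (M.toBase r)
  | 0 => smooth_id
  | r + 1 => (smooth_toBase r).comp (smooth_proj (M.iter r))

theorem isOpen_setOf_snd_ne_zero :
    IsOpen {ξ : TangentBundle M.I M | ξ.2 ≠ 0} := by
  rw [isOpen_iff_mem_nhds]
  intro ξ₀ h₀
  let e := trivializationAt M.E (TangentSpace M.I : M → Type) ξ₀.proj
  -- A trivialization is a linear isomorphism on fibres, so non-vanishing can be tested on its
  -- continuous fibre coordinate.
  have hmem : ∀ ξ ∈ e.source, (e ξ).2 = 0 ↔ ξ.2 = 0 := fun ξ hξ => by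
    have hb : ξ.proj ∈ e.baseSet := e.mem_source.1 hξ
    exact (e.continuousLinearEquivAt ℝ ξ.proj hb).map_eq_zero_iff (x := ξ.2)
  have hs : e.source ∈ 𝓝 ξ₀ :=
    e.open_source.mem_nhds (e.mem_source.2 (mem_baseSet_trivializationAt M.E _ _))
  have hc : ContinuousAt (fun ξ => (e ξ).2) ξ₀ :=
    continuous_snd.continuousAt.comp (e.continuousOn.continuousAt hs)
  filter_upwards [hs, hc.eventually_ne (fun h => h₀ ((hmem ξ₀ (mem_of_mem_nhds hs)).1 h))]
    with ξ h1 h2 h3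
  exact h2 ((hmem ξ h1).2 h3)

theorem isOpen_slashed (r : ℕ) : IsOpen (M.slashed r) :=
  (isOpen_setOf_snd_ne_zero M).preimage (ContMDiff.continuous (M.smooth_toBase r).D)

variable {M}

theorem D_mem_slashed_iff {r s : ℕ} {f : M.iter r → M.iter s} (hf : Smooth f)
    (hb : M.toBase s ∘ f = M.toBase r) (ξ : M.iter (r + 1)) :
    D f ξ ∈ M.slashed s ↔ ξ ∈ M.slashed r := by
  have h : D (M.toBase s) (D f ξ) = D (M.toBase r) ξ :=
    (D_comp_apply ((M.smooth_toBase s).diffAt _) (hf.diffAt _)).symm.trans (by rw [hb])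
  change (D (M.toBase s) (D f ξ) : TangentBundle M.I M).2 ≠ 0 ↔
    (D (M.toBase r) ξ : TangentBundle M.I M).2 ≠ 0
  rw [h]

theorem D_proj_preimage_slashed (r : ℕ) :
    D (M.iter r).proj ⁻¹' M.slashed r = M.slashed (r + 1) :=
  Set.ext fun ξ => D_mem_slashed_iff (r := r + 1) (smooth_proj (M.iter r)) rfl ξ

theorem contMDiffOn_completeLift {S : M.iter 1 → M.iter 2}
    (hS : ContMDiffOn (M.iter 1).I (M.iter 2).I ∞ S (M.slashed 0)) :
    ∀ r, ContMDiffOn (M.iter (r + 1)).I (M.iter (r + 2)).I ∞ (M.completeLift S r) (M.slashed r)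
  | 0 => hS
  | r + 1 => by
    rw [← D_proj_preimage_slashed]
    exact contMDiffOn_lift (M.isOpen_slashed r) (contMDiffOn_completeLift hS r)

theorem diffAt_completeLift {S : M.iter 1 → M.iter 2}
    (hS : ContMDiffOn (M.iter 1).I (M.iter 2).I ∞ S (M.slashed 0)) {r : ℕ}
    {ξ : M.iter (r + 1)} (hξ : ξ ∈ M.slashed r) : DiffAt (M.completeLift S r) ξ :=
  ((contMDiffOn_completeLift hS r).contMDiffAt
    ((M.isOpen_slashed r).mem_nhds hξ)).mdifferentiableAt (by simp)

theorem D_D_proj_completeLift (S : M.iter 1 → M.iter 2) (r : ℕ) (ξ : M.iter (r + 2)) :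
    D (D (M.iter r).proj) (M.completeLift S (r + 1) ξ) =
      M.completeLift S r (D (M.iter r).proj ξ) :=
  D_D_proj_lift (M.completeLift S r) ξ

theorem D_D_D_proj_completeLift {S : M.iter 1 → M.iter 2}
    (hS : ContMDiffOn (M.iter 1).I (M.iter 2).I ∞ S (M.slashed 0)) (r : ℕ)
    {ξ : M.iter (r + 3)} (hξ : ξ ∈ M.slashed (r + 2)) :
    D (D (D (M.iter r).proj)) (M.completeLift S (r + 2) ξ) =
      M.completeLift S (r + 1) (D (D (M.iter r).proj) ξ) := by
  rw [← D_proj_preimage_slashed] at hξ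
  have hξ' := hξ
  rw [← D_proj_preimage_slashed] at hξ'
  exact D_D_D_lift (smooth_proj (M.iter r)) (diffAt_completeLift hS hξ)
    (diffAt_completeLift hS hξ') (Eventually.of_forall (D_D_proj_completeLift S r))

theorem IsGeodesicOn.comp {r s : ℕ} {f : M.iter r → M.iter s} (hf : Smooth f)
    (hb : M.toBase s ∘ f = M.toBase r) {S : M.iter (r + 1) → M.iter (r + 2)}
    {S' : M.iter (s + 1) → M.iter (s + 2)}
    (h : ∀ ξ ∈ M.slashed r, D (D f) (S ξ) = S' (D f ξ)) {I : Set ℝ} (hI : IsOpen I)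
    {γ : ℝ → M.iter r} (hγ : M.IsGeodesicOn r S I γ) : M.IsGeodesicOn s S' I (f ∘ γ) := by
  have hd {Q : SmoothMfd.{u}} {c : ℝ → Q} (hc : ContMDiffOn 𝓘(ℝ, ℝ) Q.I ∞ c I) {t : ℝ}
      (ht : t ∈ I) : MDifferentiableAt 𝓘(ℝ, ℝ) Q.I c t :=
    (hc.contMDiffAt (hI.mem_nhds ht)).mdifferentiableAt (by simp)
  have hv : ∀ t ∈ I, velocity (f ∘ γ) t = D f (velocity γ t) := fun t ht =>
    velocity_comp (hf.diffAt _) (hd hγ.contMDiffOn ht)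
  refine ⟨ContMDiff.comp_contMDiffOn hf hγ.contMDiffOn, fun t ht => ?_, fun t ht => ?_⟩
  · rw [hv t ht]
    exact (D_mem_slashed_iff hf hb _).2 (hγ.regular t ht)
  -- Since `I` is open, the first-order identity holds near `t` and can be differentiated again.
  · have he : velocity (f ∘ γ) =ᶠ[𝓝 t] D f ∘ velocity γ :=
      eventually_of_mem (hI.mem_nhds ht) hv
    rw [velocity_congr he, hv t ht, ← h _ (hγ.regular t ht), ← hγ.geodesic_eq t ht]
    exact velocity_comp (hf.D.diffAt _) (hd (contMDiffOn_velocity hI hγ.contMDiffOn) ht)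

theorem IsGeodesicOn.proj_comp {S : M.iter 1 → M.iter 2} {r : ℕ} {I : Set ℝ} (hI : IsOpen I)
    {γ : ℝ → M.iter (r + 1)} (hγ : M.IsGeodesicOn (r + 1) (M.completeLift S (r + 1)) I γ) :
    M.IsGeodesicOn r (M.completeLift S r) I ((M.iter r).proj ∘ γ) :=
  IsGeodesicOn.comp (r := r + 1) (smooth_proj (M.iter r)) rfl
    (fun ξ _ => D_D_proj_completeLift S r ξ) hI hγ

theorem IsGeodesicOn.D_proj_comp {S : M.iter 1 → M.iter 2}
    (hS : ContMDiffOn (M.iter 1).I (M.iter 2).I ∞ S (M.slashed 0)) {r : ℕ} {I : Set ℝ}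
    (hI : IsOpen I) {γ : ℝ → M.iter (r + 2)}
    (hγ : M.IsGeodesicOn (r + 2) (M.completeLift S (r + 2)) I γ) :
    M.IsGeodesicOn (r + 1) (M.completeLift S (r + 1)) I (D (M.iter r).proj ∘ γ) :=
  IsGeodesicOn.comp (r := r + 2) (s := r + 1) (smooth_proj (M.iter r)).D rfl
    (fun _ hξ => D_D_D_proj_completeLift hS r hξ) hI hγ

/-! ### The canonical projections and their distinctness. -/

theorem canonicalProj_castSucc (r : ℕ) (i : Fin (r + 1)) :
    M.canonicalProj (r + 2) i.castSucc = M.canonicalProj (r + 1) i ∘ (M.iter (r + 1)).proj :=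
  Fin.lastCases_castSucc ..

theorem canonicalProj_last (r : ℕ) :
    M.canonicalProj (r + 2) (Fin.last (r + 1)) =
      M.canonicalProj (r + 1) (Fin.last r) ∘ D (M.iter r).proj :=
  Fin.lastCases_last ..

theorem smooth_canonicalProj : ∀ (r : ℕ) (i : Fin (r + 1)), Smooth (M.canonicalProj (r + 1) i)
  | 0, _ => smooth_id
  | r + 1, i => by
    induction i using Fin.lastCases with
    | last =>
      rw [canonicalProj_last]
      exact (smooth_canonicalProj r _).comp (smooth_proj (M.iter r)).D
    | cast i =>
      rw [canonicalProj_castSucc]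
      exact (smooth_canonicalProj r i).comp (smooth_proj (M.iter (r + 1)))

theorem IsGeodesicOn.canonicalProj_comp {S : M.iter 1 → M.iter 2}
    (hS : ContMDiffOn (M.iter 1).I (M.iter 2).I ∞ S (M.slashed 0)) {I : Set ℝ} (hI : IsOpen I) :
    ∀ (r : ℕ) (i : Fin (r + 1)) {γ : ℝ → M.iter (r + 1)},
      M.IsGeodesicOn (r + 1) (M.completeLift S (r + 1)) I γ →
      M.IsGeodesicOn 1 (M.completeLift S 1) I (M.canonicalProj (r + 1) i ∘ γ)
  | 0, _, _, hγ => hγ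
  | r + 1, i, _, hγ => by
    induction i using Fin.lastCases with
    | last =>
      rw [canonicalProj_last]
      exact canonicalProj_comp hS hI r _ (hγ.D_proj_comp hS hI)
    | cast i =>
      rw [canonicalProj_castSucc]
      exact canonicalProj_comp hS hI r i (hγ.proj_comp hI)

theorem exists_canonicalProj_last_ne [Nontrivial M.E] : ∀ (r : ℕ) (x : M.iter r),
    ∃ ξ η : M.iter (r + 1), (M.iter r).proj ξ = x ∧ (M.iter r).proj η = x ∧
      M.canonicalProj (r + 1) (Fin.last r) ξ ≠ M.canonicalProj (r + 1) (Fin.last r) η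
  | 0, x => by
    obtain ⟨v, hv⟩ := exists_ne (0 : M.E)
    refine ⟨(⟨x, v⟩ : TangentBundle M.I M), (⟨x, (0 : M.E)⟩ : TangentBundle M.I M), rfl, rfl,
      fun h => hv ?_⟩
    exact eq_of_heq (TotalSpace.mk.inj h).2
  | r + 1, x => by
    obtain ⟨ξ, η, hξ, hη, hne⟩ := exists_canonicalProj_last_ne r ((M.iter r).proj x)
    -- With `x = (z, y)` and `ζ = (z, w)`, the point `θ = (z, y, w, 0)` has `π θ = x` and `Dπ θ =
    -- ζ`; the last coordinate is arbitrary. Separated points thus lift to the fibre over `x`.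
    have key : ∀ ζ : M.iter (r + 1), (M.iter r).proj ζ = (M.iter r).proj x →
        ∃ θ : M.iter (r + 2), (M.iter (r + 1)).proj θ = x ∧ D (M.iter r).proj θ = ζ := by
      intro ζ hζ
      obtain ⟨x, y⟩ := x
      obtain ⟨z, w⟩ := ζ
      obtain rfl : z = x := hζ
      exact ⟨(M.iter r).flip (⟨⟨z, w⟩, (y, 0)⟩ :
        TangentBundle (M.iter r).I.tangent (TangentBundle (M.iter r).I (M.iter r))), rfl,
        D_proj_flip _⟩
    obtain ⟨ξ', h1, h2⟩ := key ξ hξ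
    obtain ⟨η', h3, h4⟩ := key η hη
    refine ⟨ξ', η', h1, h3, ?_⟩
    rw [canonicalProj_last]
    rintro h
    apply hne
    rw [← h2, ← h4]
    exact h

theorem nonempty_iter [Nonempty M] : ∀ r, Nonempty (M.iter r)
  | 0 => ‹_›
  | r + 1 => by
    obtain ⟨x⟩ := nonempty_iter r
    exact ⟨(⟨x, (0 : (M.iter r).E)⟩ : TangentBundle (M.iter r).I (M.iter r))⟩

theorem canonicalProj_last_ne_castSucc [Nontrivial M.E] [Nonempty M] (r : ℕ) (i : Fin (r + 1)) :
    M.canonicalProj (r + 2) (Fin.last (r + 1)) ≠ M.canonicalProj (r + 2) i.castSucc := by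
  intro h
  obtain ⟨x⟩ := nonempty_iter (M := M) (r + 1)
  obtain ⟨ξ, η, hξ, hη, hne⟩ := exists_canonicalProj_last_ne (r + 1) x
  apply hne
  rw [h, canonicalProj_castSucc]
  exact congrArg (M.canonicalProj (r + 1) i) (hξ.trans hη.symm)

theorem surjective_proj (N : SmoothMfd.{u}) : Function.Surjective N.proj := fun x =>
  ⟨(⟨x, (0 : N.E)⟩ : TangentBundle N.I N), rfl⟩

theorem canonicalProj_injective [Nontrivial M.E] [Nonempty M] :
    ∀ r, Function.Injective (M.canonicalProj (r + 1))
  | 0 => fun _ _ _ => Subsingleton.elim (α := Fin 1) _ _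
  | r + 1 => by
    intro i j hij
    induction i using Fin.lastCases with
    | last =>
      induction j using Fin.lastCases with
      | last => rfl
      | cast j => exact absurd hij (canonicalProj_last_ne_castSucc r j)
    | cast i =>
      induction j using Fin.lastCases with
      | last => exact absurd hij.symm (canonicalProj_last_ne_castSucc r i)
      | cast j =>
        -- Both maps factor through the surjection `π`, which can be cancelled.
        rw [canonicalProj_castSucc, canonicalProj_castSucc] at hij
        exact congrArg _ (canonicalProj_injective r
          ((surjective_proj (M.iter (r + 1))).injective_comp_right hij))

end SmoothMfd

end

theorem mainTheorem6 {n : ℕ} (hn : 1 ≤ n) (M : Type*) [TopologicalSpace M] [T2Space M]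
    [SecondCountableTopology M] [Nonempty M] [ChartedSpace (EuclideanSpace ℝ (Fin n)) M]
    [IsManifold (𝓡 n) ∞ M] (r : ℕ) (hr : 1 ≤ r) :
    Function.Injective ((SmoothMfd.of n M).canonicalProj r) ∧
    (∀ i : Fin r, ContMDiff ((SmoothMfd.of n M).iter r).I ((SmoothMfd.of n M).iter 1).I ∞
      ((SmoothMfd.of n M).canonicalProj r i)) ∧
    ∀ S : (SmoothMfd.of n M).iter 1 → (SmoothMfd.of n M).iter 2,
      (SmoothMfd.of n M).IsSemispray 0 S →
      ∀ I : Set ℝ, IsOpen I → I.OrdConnected →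
      ∀ j : ℝ → (SmoothMfd.of n M).iter r,
        (SmoothMfd.of n M).IsGeodesicOn r ((SmoothMfd.of n M).completeLift S r) I j →
        ∀ i : Fin r, (SmoothMfd.of n M).IsGeodesicOn 1 ((SmoothMfd.of n M).completeLift S 1) I
          ((SmoothMfd.of n M).canonicalProj r i ∘ j) := by
  obtain ⟨r, rfl⟩ : ∃ k, r = k + 1 := ⟨r - 1, by omega⟩
  -- Positive dimension provides the non-zero vector that starts the separation of points.
  have : Nonempty (Fin n) := ⟨⟨0, hn⟩⟩
  have : Nontrivial (SmoothMfd.of n M).E :=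
    inferInstanceAs (Nontrivial (EuclideanSpace ℝ (Fin n)))
  have : Nonempty (SmoothMfd.of n M) := ‹Nonempty M›
  exact ⟨SmoothMfd.canonicalProj_injective r, SmoothMfd.smooth_canonicalProj r,
    fun S hS I hI _ j hj i => hj.canonicalProj_comp hS.contMDiffOn hI r i⟩
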